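/- Let $\mathbb K\in\{\mathbb R,\mathbb C\}$. For a Banach space $X$ over $\mathbb K$ write $B_X$ and $S_X$ for its closed unit ball and unit sphere, and for $x^*\in S_{X^*}$ and $\alpha>0$ put $$S(B_X,x^*,\alpha)=\{x\in B_X:\operatorname{Re}x^*(x)>1-\alpha\}.$$ The space $X$ is called lush if for all $u,v\in S_X$ and every $\varepsilon>0$ there is $x^*\in S_{X^*}$ such that $$u\in S(B_X,x^*,\varepsilon)\quad\text{and}\quad \operatorname{dist}\bigl(v,\operatorname{co}(\mathbb T\,S(B_X,x^*,\varepsilon))\bigr)<\varepsilon,$$ where $\mathbb T=\{\omega\in\mathbb K:|\omega|=1\}$ and $\operatorname{co}$ denotes the convex hull. A closed subspace $X$ of a Banach space $Z$ is called an M-ideal in $Z$ if its annihilator $X^\perp=\{z^*\in Z^*: z^*(x)=0 \text{ for all } x\in X\}$ is an L-summand of $Z^*$, that is, if there is a linear projection $P\colon Z^*\to Z^*$ with range $X^\perp$ such that $\|z^*\|=\|Pz^*\|+\|z^*-Pz^*\|$ for every $z^*\in Z^*$. **Theorem.** Let $Z$ be a lush Banach space over $\mathbb K$ and let $X$ be an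 M-ideal in $Z$. Then $X$, with the norm inherited from $Z$, is lush. -/

import Mathlib

open scoped Pointwise

/-- The open slice `S(B_X, f, α) = {x ∈ B_X : Re f(x) > 1 - α}` of the closed unit ball. -/
def unitBallSlice {𝕜 X : Type*} [RCLike 𝕜] [NormedAddCommGroup X] [NormedSpace 𝕜 X]
    (f : StrongDual 𝕜 X) (α : ℝ) : Set X :=
  {x : X | x ∈ Metric.closedBall (0 : X) 1 ∧ 1 - α < RCLike.re (f x)}

/-- The absolutely convex hull `co(𝕋 F)`: the real convex hull of the set of all `ω x` with
`ω` a scalar of modulus one and `x ∈ F`. -/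
noncomputable def absCo (𝕜 : Type*) {X : Type*} [RCLike 𝕜] [NormedAddCommGroup X]
    [NormedSpace 𝕜 X] (F : Set X) : Set X :=
  letI : Module ℝ X := Module.restrictScalars ℝ 𝕜 X
  convexHull ℝ (Metric.sphere (0 : 𝕜) 1 • F)

/-- Lushness: for all `u, v ∈ S_X` and `ε > 0` there is `f ∈ S_{X*}` with
`u ∈ S(B_X, f, ε)` and `dist (v, co(𝕋 S(B_X, f, ε))) < ε`.
(The slice is nonempty as it contains `u`, so `Metric.infDist` is the genuine distance.) -/
def IsLush (𝕜 X : Type*) [RCLike 𝕜] [NormedAddCommGroup X] [NormedSpace 𝕜 X] : Prop :=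
  ∀ u ∈ Metric.sphere (0 : X) 1, ∀ v ∈ Metric.sphere (0 : X) 1, ∀ ε : ℝ, 0 < ε →
    ∃ f ∈ Metric.sphere (0 : StrongDual 𝕜 X) 1,
      u ∈ unitBallSlice f ε ∧ Metric.infDist v (absCo 𝕜 (unitBallSlice f ε)) < ε

/-- An L-summand is the range of an L-projection, i.e. of a linear map `P` with `P ∘ P = P` and
`‖z‖ = ‖P z‖ + ‖z - P z‖` for all `z`. -/
def IsLSummand {𝕜 Z : Type*} [RCLike 𝕜] [NormedAddCommGroup Z] [NormedSpace 𝕜 Z]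
    (Y : Submodule 𝕜 Z) : Prop :=
  ∃ P : Module.End 𝕜 Z, IsLprojection Z P ∧ LinearMap.range P = Y

/-- An M-ideal is a closed subspace `X` of `Z` whose annihilator `X^⊥` is an L-summand of `Z*`.
(For a subspace, Mathlib's polar is the annihilator, see `mem_polarSubmodule_iff_annihilates`.) -/
def IsMIdeal {𝕜 Z : Type*} [RCLike 𝕜] [NormedAddCommGroup Z] [NormedSpace 𝕜 Z]
    (X : Submodule 𝕜 Z) : Prop :=
  IsClosed (X : Set Z) ∧ IsLSummand (StrongDual.polarSubmodule 𝕜 X)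

theorem mem_polarSubmodule_iff_annihilates {𝕜 Z : Type*} [RCLike 𝕜] [NormedAddCommGroup Z]
    [NormedSpace 𝕜 Z] (X : Submodule 𝕜 Z) (f : StrongDual 𝕜 Z) :
    f ∈ StrongDual.polarSubmodule 𝕜 X ↔ ∀ x ∈ X, f x = 0 :=
  StrongDual.mem_polarSubmodule 𝕜 X f

open RCLike

section Convexity

variable {𝕜 E : Type*} [RCLike 𝕜] [NormedAddCommGroup E] [NormedSpace 𝕜 E]

/-! The complement of `P` is an L-projection `Q` whose range consists of functionals normed by `X`,
so by Helly finitely many of them cannot tell `B_Z` from `B_X` (`exists_mem_closedBall_approx`). If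
`f` witnesses lushness of `Z` at `u, v`, then `Q f` is norm-close to `f`, and its normalized
restriction to `X` works. Otherwise a functional separating `v` from the hull in `X` would, extended
via `Q`, also separate `v` from the hull in `Z`. -/

theorem smul_mem_absCo {F : Set E} {ω : 𝕜} (hω : ‖ω‖ = 1) {x : E} (hx : x ∈ F) :
    ω • x ∈ absCo 𝕜 F := by
  let : Module ℝ E := Module.restrictScalars ℝ 𝕜 E
  exact subset_convexHull ℝ _ (Set.smul_mem_smul (by simpa using hω) hx)

theorem nonempty_absCo {F : Set E} (hF : F.Nonempty) : (absCo 𝕜 F).Nonempty :=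
  let ⟨_, hx⟩ := hF
  ⟨_, smul_mem_absCo (𝕜 := 𝕜) norm_one hx⟩

theorem le_re_of_mem_absCo {F : Set E} (h : StrongDual 𝕜 E) {s : ℝ}
    (hs : ∀ ω : 𝕜, ‖ω‖ = 1 → ∀ x ∈ F, s ≤ re (h (ω • x))) {w : E} (hw : w ∈ absCo 𝕜 F) :
    s ≤ re (h w) := by
  let : NormedSpace ℝ E := NormedSpace.restrictScalars ℝ 𝕜 E
  have hconv : Convex ℝ {y : E | s ≤ re (h y)} :=
    (convex_Ici s).linear_preimage (reLm ∘ₗ (h : E →ₗ[𝕜] 𝕜).restrictScalars ℝ)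
  refine convexHull_min ?_ hconv hw
  rintro _ ⟨ω, hω, x, hx, rfl⟩
  exact hs ω (by simpa using hω) x hx

/-- Separation of an absolutely convex hull from an open ball which it does not meet. -/
theorem exists_separating_of_le_infDist_absCo {F : Set E} {v : E} {ε : ℝ}
    (hε : ε ≤ Metric.infDist v (absCo 𝕜 F)) :
    ∃ (h : StrongDual 𝕜 E) (s : ℝ), (∀ y ∈ Metric.ball v ε, re (h y) < s) ∧
      ∀ w ∈ absCo 𝕜 F, s ≤ re (h w) := by
  let : NormedSpace ℝ E := NormedSpace.restrictScalars ℝ 𝕜 E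
  refine RCLike.geometric_hahn_banach_open (𝕜 := 𝕜) (convex_ball v ε) Metric.isOpen_ball
    (convex_convexHull ℝ _) ?_
  refine Metric.disjoint_ball_infDist.mono_left (Metric.ball_subset_ball hε)

theorem mul_norm_le_of_forall_re_le (h : StrongDual 𝕜 E) {r s : ℝ} (hr : 0 < r)
    (hs : ∀ x : E, ‖x‖ < r → re (h x) ≤ s) : r * ‖h‖ ≤ s := by
  rw [← le_div_iff₀' hr]
  refine le_of_forall_lt fun c hc => ?_
  obtain ⟨x, hx, hcx⟩ := h.exists_lt_apply_of_lt_opNorm hc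
  obtain ⟨ω, hω, hωx⟩ := RCLike.exists_norm_eq_mul_self (h x)
  refine hcx.trans_le ?_
  rw [le_div_iff₀' hr]
  have key := hs ((r : 𝕜) • ω • x) (by
    rw [norm_smul, norm_smul, hω, one_mul, norm_ofReal, abs_of_pos hr]
    exact mul_lt_of_lt_one_right hr hx)
  rwa [h.map_smul, h.map_smul, smul_eq_mul, smul_eq_mul, ← hωx, ← ofReal_mul, ofReal_re] at key

theorem convex_image_closedBall {F : Type*} [AddCommGroup F] [Module 𝕜 F] [Module ℝ F]
    [IsScalarTower ℝ 𝕜 F] (T : E →ₗ[𝕜] F) (r : ℝ) :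
    Convex ℝ (T '' Metric.closedBall (0 : E) r) := by
  let : NormedSpace ℝ E := NormedSpace.restrictScalars ℝ 𝕜 E
  exact (convex_closedBall (0 : E) r).linear_image (T.restrictScalars ℝ)

end Convexity

section MIdeal

variable {𝕜 Z : Type*} [RCLike 𝕜] [NormedAddCommGroup Z] [NormedSpace 𝕜 Z]

/-- Helly's theorem for two functionals: if restriction to a subspace preserves the norm of all
combinations of `g` and `h`, then the values of `g` and `h` at a point of the unit ball of the whole
space can be approximated by their values at points of the unit ball of the subspace. -/
theorem exists_mem_closedBall_approx (X : Submodule 𝕜 Z) (g h : StrongDual 𝕜 Z)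
    (hgh : ∀ a b : 𝕜, ‖a • g + b • h‖ ≤ ‖(a • g + b • h).comp X.subtypeL‖)
    {z : Z} (hz : ‖z‖ ≤ 1) {δ : ℝ} (hδ : 0 < δ) :
    ∃ x : X, ‖x‖ ≤ 1 ∧ ‖g x - g z‖ < δ ∧ ‖h x - h z‖ < δ := by
  let T : X →ₗ[𝕜] 𝕜 × 𝕜 := ((g.comp X.subtypeL).prod (h.comp X.subtypeL) : X →L[𝕜] 𝕜 × 𝕜)
  have hmem : (g z, h z) ∈ closure (T '' Metric.closedBall (0 : X) 1) := by
    by_contra hnot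
    obtain ⟨φ, u, hu, hzu⟩ := RCLike.geometric_hahn_banach_closed_point (𝕜 := 𝕜)
      (convex_image_closedBall T 1).closure isClosed_closure hnot
    -- Separation in `𝕜 × 𝕜` yields a combination of `g` and `h` whose real part at `z` exceeds its
    -- norm on `X`.
    set χ : StrongDual 𝕜 Z := φ (1, 0) • g + φ (0, 1) • h with hχ
    have hφ : ∀ y : Z, φ (g y, h y) = χ y := fun y => by
      have : ((g y, h y) : 𝕜 × 𝕜) = g y • (1, 0) + h y • (0, 1) := by simp
      rw [this, map_add, map_smul, map_smul, hχ]
      simp [mul_comm]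
    have hle : 1 * ‖χ.comp X.subtypeL‖ ≤ u :=
      mul_norm_le_of_forall_re_le _ one_pos fun x hx => by
        have := hu _ (subset_closure ⟨x, by simpa using hx.le, rfl⟩)
        exact (hφ x ▸ this).le
    have hbound : re (χ z) ≤ ‖χ‖ :=
      (re_le_norm _).trans ((χ.le_opNorm z).trans (mul_le_of_le_one_right (norm_nonneg _) hz))
    rw [hφ] at hzu
    linarith [hgh (φ (1, 0)) (φ (0, 1))]
  obtain ⟨_, ⟨x, hx, rfl⟩, hdist⟩ := Metric.mem_closure_iff.1 hmem δ hδ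
  refine ⟨x, by simpa using hx, ?_, ?_⟩
  · rw [← dist_eq_norm, dist_comm]
    exact (le_max_left _ _).trans_lt hdist
  · rw [← dist_eq_norm, dist_comm]
    exact (le_max_right _ _).trans_lt hdist

theorem IsMIdeal.exists_lprojection {X : Submodule 𝕜 Z} (hX : IsMIdeal X) :
    ∃ Q : Module.End 𝕜 (StrongDual 𝕜 Z),
      (∀ f, ∀ x ∈ X, Q f x = f x) ∧ (∀ f, ‖f‖ = ‖f - Q f‖ + ‖Q f‖) ∧ (∀ f, Q (Q f) = Q f) ∧
      ∀ f, ‖Q f‖ ≤ ‖f.comp X.subtypeL‖ := by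
  obtain ⟨-, P, hP, hrange⟩ := hX
  have hidem : ∀ f, P (P f) = P f := fun f => LinearMap.congr_fun hP.proj f
  have hnorm : ∀ f, ‖f‖ = ‖P f‖ + ‖f - P f‖ := fun f => hP.Lnorm f
  have hann : ∀ f, (∀ x ∈ X, f x = 0) ↔ ∃ k, P k = f := fun f => by
    rw [← mem_polarSubmodule_iff_annihilates, ← hrange, LinearMap.mem_range]
  refine ⟨1 - P, fun f x hx => ?_, fun f => ?_, fun f => ?_, fun f => ?_⟩
  · simp [(hann (P f)).2 ⟨f, rfl⟩ x hx]
  · simpa using hnorm f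
  · simp [hidem]
  -- `Q f` depends only on `f` restricted to `X`, so `f` may be replaced by a norm-preserving
  -- extension.
  · obtain ⟨ψ, hψ, hψn⟩ := exists_extension_norm_eq X (f.comp X.subtypeL)
    obtain ⟨k, hk⟩ := (hann (f - ψ)).1 fun x hx =>
      sub_eq_zero.2 (hψ ⟨x, hx⟩).symm
    have hQ : f - P f = ψ - P ψ := by
      have := hidem k
      rw [hk, map_sub] at this
      rw [sub_eq_sub_iff_sub_eq_sub, this]
    have := hnorm ψ
    change ‖f - P f‖ ≤ _
    rw [hQ, ← hψn]
    linarith [norm_nonneg (P ψ)]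

end MIdeal

theorem mainTheorem1 {𝕜 : Type*} [RCLike 𝕜] {Z : Type*} [NormedAddCommGroup Z]
    [NormedSpace 𝕜 Z] [CompleteSpace Z] (hZ : IsLush 𝕜 Z)
    (X : Submodule 𝕜 Z) (hX : IsMIdeal X) :
    IsLush 𝕜 X := by
  intro u hu v hv ε hε
  obtain ⟨Q, hQX, hQL, hQQ, hQn⟩ := hX.exists_lprojection
  have hu1 : ‖(u : Z)‖ = 1 := by simpa using hu
  have hv1 : ‖(v : Z)‖ = 1 := by simpa using hv
  -- One `η` each for the slice of `f`, for `‖f - g‖`, and for the Helly approximation. The cap at 1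
  -- keeps `1 - 3η ≥ 0`, so dividing by `‖gX‖ ≤ 1` does not decrease the values used.
  set η : ℝ := min ε 1 / 3 with hη
  have hη0 : 0 < η := by positivity
  have hηε : 3 * η ≤ ε := by linarith [min_le_left ε 1]
  have hη1 : 3 * η ≤ 1 := by linarith [min_le_right ε 1]
  obtain ⟨f, hf, ⟨-, hfu⟩, hdist⟩ := hZ u (by simpa using hu1) v (by simpa using hv1) η hη0
  have hf1 : ‖f‖ = 1 := by simpa using hf
  set g := Q f with hg
  set gX := g.comp X.subtypeL with hgX
  have hgu : re (g u) = re (f u) := by rw [hg, hQX f u u.2]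
  have hgn : 1 - η < ‖g‖ := by
    have := (re_le_norm _).trans (g.le_opNorm (u : Z))
    rw [hu1, mul_one, hgu] at this
    linarith
  have hgXle : ‖gX‖ ≤ 1 := by
    refine gX.opNorm_le_bound zero_le_one fun x => ?_
    refine (g.le_opNorm (x : Z)).trans (mul_le_mul_of_nonneg_right ?_ (norm_nonneg _))
    linarith [hQL f, norm_nonneg (f - Q f)]
  have hgX0 : 0 < ‖gX‖ := by
    have := hQn g
    rw [hg, hQQ f, ← hg] at this
    linarith
  set G : StrongDual 𝕜 X := ((‖gX‖⁻¹ : ℝ) : 𝕜) • gX with hG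
  have hGslice : ∀ x : X, ‖x‖ ≤ 1 → 1 - 3 * η < re (g x) → x ∈ unitBallSlice G ε := by
    refine fun x hx hgx => ⟨by simpa using hx, ?_⟩
    have h1 : re (G x) = ‖gX‖⁻¹ * re (g x) := by
      rw [hG, smul_apply, smul_eq_mul, re_ofReal_mul]
      rfl
    have h2 : re (g x) ≤ ‖gX‖⁻¹ * re (g x) :=
      le_mul_of_one_le_left (by linarith) ((one_le_inv₀ hgX0).2 hgXle)
    linarith
  have huG : u ∈ unitBallSlice G ε := hGslice u (by simpa using hu1.le) (by linarith)
  refine ⟨G, ?_, huG, ?_⟩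
  · rw [mem_sphere_zero_iff_norm, hG, norm_smul, norm_ofReal, abs_of_pos (inv_pos.2 hgX0),
      inv_mul_cancel₀ hgX0.ne']
  by_contra! hfar
  obtain ⟨h, s, hball, hhull⟩ := exists_separating_of_le_infDist_absCo hfar
  have hsep : ε * ‖h‖ ≤ s - re (h v) :=
    mul_norm_le_of_forall_re_le h hε fun x hx => by
      have := hball (v + x) (by simpa using hx)
      rw [map_add, map_add] at this
      linarith
  have hlt : re (h v) < s := hball v (Metric.mem_ball_self hε)
  obtain ⟨H₀, hH₀, hH₀n⟩ := exists_extension_norm_eq X h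
  set H := Q H₀ with hH
  have hHX : ∀ x : X, H x = h x := fun x => by rw [hH, hQX _ _ x.2, hH₀]
  have hHn : ‖H‖ ≤ ‖h‖ := by
    rw [← hH₀n]
    linarith [hQL H₀, norm_nonneg (H₀ - Q H₀)]
  have hslice : ∀ ω : 𝕜, ‖ω‖ = 1 → ∀ z ∈ unitBallSlice f η, s ≤ re (H (ω • z)) := by
    rintro ω hω z ⟨hz, hfz⟩
    have hz1 : ‖z‖ ≤ 1 := by simpa using hz
    have hgz : 1 - 2 * η < re (g z) := by
      have h1 : re ((f - g) z) ≤ ‖f - g‖ :=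
        (re_le_norm _).trans
          (((f - g).le_opNorm z).trans (mul_le_of_le_one_right (norm_nonneg _) hz1))
      rw [sub_apply, map_sub] at h1
      linarith [hQL f]
    refine le_of_forall_pos_le_add fun δ hδ => ?_
    obtain ⟨x, hx, hgx, hHx⟩ := exists_mem_closedBall_approx X g H
      -- `Q` fixes every combination of `g` and `H`, so restriction to `X` preserves its norm.
      (fun a b => by
        have := hQn (a • g + b • H)
        rwa [map_add, map_smul, map_smul, hg, hH, hQQ, hQQ] at this)
      hz1 (lt_min hη0 hδ)
    have hxG : x ∈ unitBallSlice G ε := hGslice x hx (by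
      have := (abs_re_le_norm (g x - g z)).trans_lt (hgx.trans_le (min_le_left _ _))
      rw [map_sub] at this
      linarith [(abs_lt.1 this).1])
    have hs := hhull _ (smul_mem_absCo hω hxG)
    have hre : re (ω * (H x - H z)) ≤ δ := by
      refine (re_le_norm _).trans ?_
      rw [norm_mul, hω, one_mul]
      exact (hHx.trans_le (min_le_right _ _)).le
    rw [map_smul, smul_eq_mul, ← hHX] at hs
    rw [mul_sub, map_sub] at hre
    rw [map_smul, smul_eq_mul]
    linarith
  obtain ⟨w, hw, hvw⟩ := (Metric.infDist_lt_iff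
    (nonempty_absCo (F := unitBallSlice f η) ⟨u, by simpa using hu1.le, hfu⟩)).1 hdist
  have hsw := le_re_of_mem_absCo H hslice hw
  have hwv : re (H w) - re (h v) ≤ ‖h‖ * η := by
    rw [← hHX, ← map_sub, ← map_sub]
    refine (re_le_norm _).trans ((H.le_opNorm _).trans ?_)
    rw [dist_comm, dist_eq_norm] at hvw
    exact mul_le_mul hHn hvw.le (norm_nonneg _) (norm_nonneg _)
  -- The gap `s - re (h v)` is positive, at least `ε‖h‖` and at most `η‖h‖`, contradicting `η < ε`.
  have hpos : 0 < ‖h‖ := by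
    by_contra! hle
    nlinarith
  nlinarith
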